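/- Let $\Bbbk=\mathbb{R}$ or $\mathbb{C}$, with $\langle x,y\rangle=x^*y$ and $\lVert\cdot\rVert$ the Euclidean (Hermitian) inner product and norm on $\Bbbk^d$. For a Hermitian $A=(a_{ij})\in\Bbbk^{n\times n}$, and for $B=(b_{ij})\in\Bbbk^{m\times n}$, put \[ \lVert A\rVert_\gamma^\Bbbk=\max_{\lVert x_i\rVert=1}\Bigl|\sum_{i,j}a_{ij}\langle x_i,x_j\rangle\Bigr|,\quad \lVert A\rVert_\Gamma^\Bbbk=\max_{\lVert x_i\rVert\le1}\Bigl|\sum_{i,j}a_{ij}\langle x_i,x_j\rangle\Bigr|,\quad \lVert B\rVert_{\mathsf G}^\Bbbk=\max_{\lVert x_i\rVert\le1,\lVert y_j\rVert\le1}\Bigl|\sum_{i,j}b_{ij}\langle x_i,y_j\rangle\Bigr|, \] where the vectors range over $\Bbbk^d$ with $d\ge n$ in the first two maxima and $d\ge m+n$ in the third (the values do not depend on such $d$), and \[ \lVert A\rVert_\theta^\Bbbk=\max_{|\delta_i|=1}\Bigl|\sum_{i,j}a_{ij}\bar\delta_i\delta_j\Bigr|,\quad \lVert A\rVert_\Theta^\Bbbk=\max_{|\delta_i|\le1}\Bigl|\sum_{i,j}a_{ij}\bar\delta_i\delta_j\Bigr|,\quad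 \lVert B\rVert_{\infty,1}^\Bbbk=\max_{|\varepsilon_i|\le1,|\delta_j|\le1}\Bigl|\sum_{i,j}b_{ij}\bar\varepsilon_i\delta_j\Bigr|, \] where the scalars range over $\Bbbk$. Let \[ \varphi_{\mathbb R}(x)=\frac2\pi\arcsin x,\qquad \varphi_{\mathbb C}(z)=\frac\pi4\sum_{k=0}^\infty\Bigl(\frac{(2k-1)!!}{(2k)!!}\Bigr)^2\frac1{k+1}\,z|z|^{2k},\qquad \alpha_{\mathsf{GW}}^\Bbbk=\inf_{0\le x\le1}\frac{1+\varphi_\Bbbk(x)}{1+x}, \] and $a_0^{\mathbb R}=2/\pi$, $a_0^{\mathbb C}=\pi/4$. Then for every $n$ and every real symmetric matrix $A\in\mathbb{R}^{n\times n}$ that is diagonally dominant, i.e. $a_{ii}\ge\sum_{j\ne i}|a_{ij}|$ for all $i$, and for both $\Bbbk=\mathbb{R}$ and $\Bbbk=\mathbb{C}$, \[ \lVert A\rVert_\gamma^\Bbbk\le\Bigl(1+\frac{1-a_0^\Bbbk}{\alpha_{\mathsf{GW}}^\Bbbk}\Bigr)\lVert A\rVert_\theta^\Bbbk . \] In this inequality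 $\lVert\cdot\rVert_\gamma^\Bbbk$ may be replaced by $\lVert\cdot\rVert_\Gamma^\Bbbk$ or $\lVert\cdot\rVert_{\mathsf G}^\Bbbk$, and $\lVert\cdot\rVert_\theta^\Bbbk$ may be replaced, independently, by $\lVert\cdot\rVert_\Theta^\Bbbk$ or $\lVert\cdot\rVert_{\infty,1}^\Bbbk$. -/

import Mathlib

namespace Groth

section Norms

variable {𝕜 : Type*} [RCLike 𝕜] {m n : ℕ}

/-- The `(γ, d)`-seminorm: the maximum of `|∑ᵢ ∑ⱼ aᵢⱼ ⟨xᵢ, xⱼ⟩|` over unit vectors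
`x₁, …, xₙ ∈ 𝕜ᵈ`. (`inner` is conjugate-linear in its first argument, so `⟨x, y⟩ = x* y`.) -/
noncomputable def gammaSeminorm (d : ℕ) (A : Matrix (Fin n) (Fin n) 𝕜) : ℝ :=
  sSup {r : ℝ | ∃ x : Fin n → EuclideanSpace 𝕜 (Fin d), (∀ i, ‖x i‖ = 1) ∧
    r = ‖∑ i, ∑ j, A i j * inner 𝕜 (x i) (x j)‖}

/-- The `(Γ, d)`-norm: as the `(γ, d)`-seminorm, but over vectors of norm at most one. -/
noncomputable def capGammaNorm (d : ℕ) (A : Matrix (Fin n) (Fin n) 𝕜) : ℝ :=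
  sSup {r : ℝ | ∃ x : Fin n → EuclideanSpace 𝕜 (Fin d), (∀ i, ‖x i‖ ≤ 1) ∧
    r = ‖∑ i, ∑ j, A i j * inner 𝕜 (x i) (x j)‖}

/-- The `(G, d)`-norm of a rectangular matrix: the maximum of `|∑ᵢ ∑ⱼ bᵢⱼ ⟨xᵢ, yⱼ⟩|` over
vectors `xᵢ, yⱼ ∈ 𝕜ᵈ` of norm at most one. -/
noncomputable def gNorm (d : ℕ) (B : Matrix (Fin m) (Fin n) 𝕜) : ℝ :=
  sSup {r : ℝ | ∃ (x : Fin m → EuclideanSpace 𝕜 (Fin d)) (y : Fin n → EuclideanSpace 𝕜 (Fin d)),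
    (∀ i, ‖x i‖ ≤ 1) ∧ (∀ j, ‖y j‖ ≤ 1) ∧
    r = ‖∑ i, ∑ j, B i j * inner 𝕜 (x i) (y j)‖}

/-- The `θ`-seminorm: the maximum of `|∑ᵢ ∑ⱼ aᵢⱼ δ̄ᵢ δⱼ|` over scalars `δᵢ ∈ 𝕜`, `|δᵢ| = 1`. -/
noncomputable def thetaSeminorm (A : Matrix (Fin n) (Fin n) 𝕜) : ℝ :=
  sSup {r : ℝ | ∃ δ : Fin n → 𝕜, (∀ i, ‖δ i‖ = 1) ∧
    r = ‖∑ i, ∑ j, A i j * (star (δ i) * δ j)‖}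

/-- The `Θ`-norm: as the `θ`-seminorm, but over scalars of absolute value at most one. -/
noncomputable def capThetaNorm (A : Matrix (Fin n) (Fin n) 𝕜) : ℝ :=
  sSup {r : ℝ | ∃ δ : Fin n → 𝕜, (∀ i, ‖δ i‖ ≤ 1) ∧
    r = ‖∑ i, ∑ j, A i j * (star (δ i) * δ j)‖}

/-- The `(∞, 1)`-norm of a rectangular matrix: the maximum of `|∑ᵢ ∑ⱼ bᵢⱼ ε̄ᵢ δⱼ|` over scalars
of absolute value at most one. -/
noncomputable def inftyOneNorm (B : Matrix (Fin m) (Fin n) 𝕜) : ℝ :=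
  sSup {r : ℝ | ∃ (ε : Fin m → 𝕜) (δ : Fin n → 𝕜), (∀ i, ‖ε i‖ ≤ 1) ∧ (∀ j, ‖δ j‖ ≤ 1) ∧
    r = ‖∑ i, ∑ j, B i j * (star (ε i) * δ j)‖}

/-! The suprema above are attained maxima. -/

theorem isGreatest_sSup_of_compact {X : Type*} [TopologicalSpace X] {K : Set X}
    (hK : IsCompact K) (hne : K.Nonempty) {f : X → ℝ} (hf : Continuous f) {S : Set ℝ}
    (hS : S = f '' K) : IsGreatest S (sSup S) := by
  subst hS
  exact (hK.image hf).isGreatest_sSup (hne.image f)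

theorem compact_le {ι E : Type*} [SeminormedAddCommGroup E] [ProperSpace E] :
    IsCompact {x : ι → E | ∀ i, ‖x i‖ ≤ 1} := by
  have : {x : ι → E | ∀ i, ‖x i‖ ≤ 1} = Set.univ.pi fun _ => Metric.closedBall (0 : E) 1 := by
    ext x; simp
  rw [this]
  exact isCompact_univ_pi fun _ => isCompact_closedBall _ _

theorem compact_eq {ι E : Type*} [SeminormedAddCommGroup E] [ProperSpace E] :
    IsCompact {x : ι → E | ∀ i, ‖x i‖ = 1} := by
  have : {x : ι → E | ∀ i, ‖x i‖ = 1} = Set.univ.pi fun _ => Metric.sphere (0 : E) 1 := by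
    ext x; simp
  rw [this]
  exact isCompact_univ_pi fun _ => isCompact_sphere _ _

theorem gammaSeminorm_isGreatest {d : ℕ} (hd : n ≤ d) (A : Matrix (Fin n) (Fin n) 𝕜) :
    IsGreatest {r : ℝ | ∃ x : Fin n → EuclideanSpace 𝕜 (Fin d), (∀ i, ‖x i‖ = 1) ∧
      r = ‖∑ i, ∑ j, A i j * inner 𝕜 (x i) (x j)‖} (gammaSeminorm d A) := by
  refine isGreatest_sSup_of_compact (K := {x : Fin n → EuclideanSpace 𝕜 (Fin d) | ∀ i, ‖x i‖ = 1})
    (f := fun x => ‖∑ i, ∑ j, A i j * inner 𝕜 (x i) (x j)‖) compact_eq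
    ⟨fun i => EuclideanSpace.single (Fin.castLE hd i) 1, fun i => by simp⟩ (by fun_prop) ?_
  ext r; simp [eq_comm]

theorem capGammaNorm_isGreatest (d : ℕ) (A : Matrix (Fin n) (Fin n) 𝕜) :
    IsGreatest {r : ℝ | ∃ x : Fin n → EuclideanSpace 𝕜 (Fin d), (∀ i, ‖x i‖ ≤ 1) ∧
      r = ‖∑ i, ∑ j, A i j * inner 𝕜 (x i) (x j)‖} (capGammaNorm d A) := by
  refine isGreatest_sSup_of_compact (K := {x : Fin n → EuclideanSpace 𝕜 (Fin d) | ∀ i, ‖x i‖ ≤ 1})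
    (f := fun x => ‖∑ i, ∑ j, A i j * inner 𝕜 (x i) (x j)‖) compact_le
    ⟨0, fun i => by simp⟩ (by fun_prop) ?_
  ext r; simp [eq_comm]

theorem gNorm_isGreatest (d : ℕ) (B : Matrix (Fin m) (Fin n) 𝕜) :
    IsGreatest {r : ℝ | ∃ (x : Fin m → EuclideanSpace 𝕜 (Fin d))
      (y : Fin n → EuclideanSpace 𝕜 (Fin d)), (∀ i, ‖x i‖ ≤ 1) ∧ (∀ j, ‖y j‖ ≤ 1) ∧
      r = ‖∑ i, ∑ j, B i j * inner 𝕜 (x i) (y j)‖} (gNorm d B) := by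
  refine isGreatest_sSup_of_compact
    (K := {x : Fin m → EuclideanSpace 𝕜 (Fin d) | ∀ i, ‖x i‖ ≤ 1} ×ˢ
      {y : Fin n → EuclideanSpace 𝕜 (Fin d) | ∀ i, ‖y i‖ ≤ 1})
    (f := fun p => ‖∑ i, ∑ j, B i j * inner 𝕜 (p.1 i) (p.2 j)‖) (compact_le.prod compact_le)
    ⟨0, by simp⟩ (by fun_prop) ?_
  ext r; simp [eq_comm, and_assoc]

theorem thetaSeminorm_isGreatest (A : Matrix (Fin n) (Fin n) 𝕜) :
    IsGreatest {r : ℝ | ∃ δ : Fin n → 𝕜, (∀ i, ‖δ i‖ = 1) ∧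
      r = ‖∑ i, ∑ j, A i j * (star (δ i) * δ j)‖} (thetaSeminorm A) := by
  refine isGreatest_sSup_of_compact (K := {x : Fin n → 𝕜 | ∀ i, ‖x i‖ = 1})
    (f := fun δ => ‖∑ i, ∑ j, A i j * (star (δ i) * δ j)‖) compact_eq
    ⟨1, fun i => by simp⟩ (by fun_prop) ?_
  ext r; simp [eq_comm]

theorem capThetaNorm_isGreatest (A : Matrix (Fin n) (Fin n) 𝕜) :
    IsGreatest {r : ℝ | ∃ δ : Fin n → 𝕜, (∀ i, ‖δ i‖ ≤ 1) ∧
      r = ‖∑ i, ∑ j, A i j * (star (δ i) * δ j)‖} (capThetaNorm A) := by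
  refine isGreatest_sSup_of_compact (K := {x : Fin n → 𝕜 | ∀ i, ‖x i‖ ≤ 1})
    (f := fun δ => ‖∑ i, ∑ j, A i j * (star (δ i) * δ j)‖) compact_le
    ⟨1, fun i => by simp⟩ (by fun_prop) ?_
  ext r; simp [eq_comm]

theorem inftyOneNorm_isGreatest (B : Matrix (Fin m) (Fin n) 𝕜) :
    IsGreatest {r : ℝ | ∃ (ε : Fin m → 𝕜) (δ : Fin n → 𝕜), (∀ i, ‖ε i‖ ≤ 1) ∧
      (∀ j, ‖δ j‖ ≤ 1) ∧ r = ‖∑ i, ∑ j, B i j * (star (ε i) * δ j)‖} (inftyOneNorm B) := by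
  refine isGreatest_sSup_of_compact
    (K := {x : Fin m → 𝕜 | ∀ i, ‖x i‖ ≤ 1} ×ˢ {y : Fin n → 𝕜 | ∀ i, ‖y i‖ ≤ 1})
    (f := fun p => ‖∑ i, ∑ j, B i j * (star (p.1 i) * p.2 j)‖) (compact_le.prod compact_le)
    ⟨0, by simp⟩ (by fun_prop) ?_
  ext r; simp [eq_comm, and_assoc]

end Norms

section Constants

/-- `φ_ℝ(x) = (2/π) arcsin x`, used for `x ∈ [-1, 1]`. -/
noncomputable def phiReal (x : ℝ) : ℝ := 2 / Real.pi * Real.arcsin x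

/-- The coefficient `((2k-1)!!/(2k)!!)² / (k+1)`; for `k = 0` it is `1`, as
`(-1)!! = 0!! = 1` (the truncated `2 * 0 - 1 = 0` gives the right value). -/
noncomputable def phiCoeff (k : ℕ) : ℝ :=
  ((Nat.doubleFactorial (2 * k - 1) : ℝ) / (Nat.doubleFactorial (2 * k) : ℝ)) ^ 2 * (1 / ((k : ℝ) + 1))

/-- `φ_ℂ(z) = (π/4) ∑ₖ ((2k-1)!!/(2k)!!)² (1/(k+1)) z |z|²ᵏ`, used for `|z| ≤ 1`. -/
noncomputable def phiComplex (z : ℂ) : ℂ :=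
  (Real.pi : ℂ) / 4 * ∑' k : ℕ, (phiCoeff k : ℂ) * (z * (‖z‖ : ℂ) ^ (2 * k))

theorem phiCoeff_nonneg (k : ℕ) : 0 ≤ phiCoeff k := by
  unfold phiCoeff; positivity

theorem doubleFactorial_ratio_sq_le (k : ℕ) :
    ((Nat.doubleFactorial (2 * k - 1) : ℝ) / (Nat.doubleFactorial (2 * k) : ℝ)) ^ 2
      ≤ 1 / ((k : ℝ) + 1) := by
  induction k with
  | zero => simp
  | succ k ih =>
    have h1 : (Nat.doubleFactorial (2 * (k + 1) - 1) : ℝ)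
        = (2 * k + 1) * Nat.doubleFactorial (2 * k - 1) := by
      rcases k with _ | k
      · simp
      · have : 2 * (k + 1 + 1) - 1 = (2 * (k + 1) - 1) + 2 := by omega
        rw [this, Nat.doubleFactorial_add_two]
        push_cast [show 2 * (k + 1) - 1 = 2 * k + 1 by omega]
        ring
    have h2 : (Nat.doubleFactorial (2 * (k + 1)) : ℝ)
        = (2 * k + 2) * Nat.doubleFactorial (2 * k) := by
      rw [show 2 * (k + 1) = 2 * k + 2 by ring, Nat.doubleFactorial_add_two]
      push_cast; ring
    rw [h1, h2, mul_div_mul_comm, mul_pow]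
    refine (mul_le_mul_of_nonneg_left ih (by positivity)).trans ?_
    rw [div_pow, div_mul_div_comm, div_le_div_iff₀ (by positivity) (by positivity)]
    push_cast
    have : (0 : ℝ) ≤ k := Nat.cast_nonneg k
    nlinarith [sq_nonneg (k : ℝ), pow_nonneg this 3]

/-- The series defining `φ_ℂ` converges absolutely on the closed unit disk. -/
theorem phiComplex_summable {z : ℂ} (hz : ‖z‖ ≤ 1) :
    Summable fun k : ℕ => (phiCoeff k : ℂ) * (z * (‖z‖ : ℂ) ^ (2 * k)) := by
  have hs : Summable fun k : ℕ => 1 / ((k : ℝ) + 1) ^ 2 := by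
    have := (summable_nat_add_iff 1).2 (Real.summable_one_div_nat_pow.2 one_lt_two)
    simpa using this
  refine Summable.of_norm_bounded hs fun k => ?_
  rw [norm_mul, norm_mul, norm_pow, Complex.norm_real, Complex.norm_real, norm_norm,
    Real.norm_of_nonneg (phiCoeff_nonneg k)]
  have h1 : phiCoeff k ≤ 1 / ((k : ℝ) + 1) ^ 2 := by
    have := mul_le_mul_of_nonneg_right (doubleFactorial_ratio_sq_le k)
      (show (0 : ℝ) ≤ 1 / ((k : ℝ) + 1) by positivity)
    refine this.trans (le_of_eq ?_)
    field_simp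
  have h2 : ‖z‖ * ‖z‖ ^ (2 * k) ≤ 1 :=
    mul_le_one₀ hz (by positivity) (pow_le_one₀ (norm_nonneg z) hz)
  calc phiCoeff k * (‖z‖ * ‖z‖ ^ (2 * k)) ≤ phiCoeff k * 1 :=
        mul_le_mul_of_nonneg_left h2 (phiCoeff_nonneg k)
    _ ≤ _ := by rwa [mul_one]

/-- `α_GW` over `ℝ`: the infimum of `(1 + φ_ℝ(x)) / (1 + x)` over `0 ≤ x ≤ 1`. -/
noncomputable def alphaReal : ℝ :=
  sInf ((fun x : ℝ => (1 + phiReal x) / (1 + x)) '' Set.Icc 0 1)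

/-- `α_GW` over `ℂ`: the infimum of `(1 + φ_ℂ(x)) / (1 + x)` over real `0 ≤ x ≤ 1`; at such `x`
the value `φ_ℂ(x)` is real, and it is read as a real number by taking its real part. -/
noncomputable def alphaComplex : ℝ :=
  sInf ((fun x : ℝ => (1 + (phiComplex (x : ℂ)).re) / (1 + x)) '' Set.Icc 0 1)

end Constants

/-- Real symmetric diagonally dominant matrices: `aᵢᵢ ≥ ∑_{j ≠ i} |aᵢⱼ|` for every `i`. -/
def IsSymmDiagDominant {n : ℕ} (A : Matrix (Fin n) (Fin n) ℝ) : Prop :=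
  A.IsSymm ∧ ∀ i, ∑ j ∈ Finset.univ.erase i, |A i j| ≤ A i i

end Groth

/-!
Write `α` for `alphaReal`. On `[-1, 1]` one has `|φ_ℝ(t) - α t| ≤ 1 - α`, with equality at `t = 1`,
so diagonal dominance makes `∑ aᵢⱼ (φ_ℝ⟨xᵢ, xⱼ⟩ - α ⟨xᵢ, xⱼ⟩)` nonnegative for real unit
vectors. By Grothendieck's identity `E[sign⟨x, g⟩ sign⟨y, g⟩] = φ_ℝ⟨x, y⟩`, for a standard Gaussian
vector `g`, the sum `∑ aᵢⱼ φ_ℝ⟨xᵢ, xⱼ⟩` is an average of values `∑ aᵢⱼ sᵢ sⱼ` at signs `sᵢ`. Hence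
`α ∑ aᵢⱼ ⟨xᵢ, xⱼ⟩ ≤ ‖A‖_θ`. Vectors of norm at most one are completed to unit vectors, two families
are handled by polarization, and complex vectors by rotating the phase of the sum and using
`Re ⟨·, ·⟩` as a real inner product. The bound `1 / α` so obtained suffices over both fields:
`1 / α ≤ 6 / 5`, while `2 / π` and `π / 4` are at most `4 / 5`.

For Grothendieck's identity one may assume `⟨x, y⟩ > 0`: replacing `y` by `-y` flips both sides,
and both vanish for orthogonal vectors. Let `z` be the reflection of `x` in the line of `y`. Then
`x + z` is a positive multiple of `y`, so the sign of `⟨y, g⟩` is that of `⟨x, g⟩` or of `⟨z, g⟩`;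
thus passing from `(x, y)` to `(x, z)` replaces the correlation `s` of signs by `2 s - 1`. It also
doubles the angle, so `φ_ℝ` changes in the same way and the error in the identity doubles. As the
error is bounded, it vanishes.
-/

namespace Groth

section SignRounding

/-- The sign of a real number as an element of `{1, -1}`: unlike `Real.sign` it is `1` at `0`, so
that rounding to signs always gives scalars of absolute value `1`. -/
noncomputable def roundSign (t : ℝ) : ℝ := if 0 ≤ t then 1 else -1

theorem abs_roundSign (t : ℝ) : |roundSign t| = 1 := by
  unfold roundSign; split_ifs <;> simp

theorem norm_roundSign_mul_roundSign (s t : ℝ) : ‖roundSign s * roundSign t‖ = 1 := by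
  rw [Real.norm_eq_abs, abs_mul, abs_roundSign, abs_roundSign, one_mul]

theorem roundSign_neg {t : ℝ} (ht : t ≠ 0) : roundSign (-t) = -roundSign t := by
  rcases ht.lt_or_gt with h | h <;>
    simp [roundSign, h.le, h.not_ge]

theorem measurable_roundSign : Measurable roundSign :=
  Measurable.ite measurableSet_Ici measurable_const measurable_const

theorem roundSign_mul_roundSign_of_add_eq {a b c k : ℝ} (hk : 0 < k) (h : a + c = k * b) :
    roundSign a * roundSign c = roundSign a * roundSign b + roundSign b * roundSign c - 1 := by
  have hpos : 0 ≤ a → 0 ≤ c → 0 ≤ b := fun ha hc =>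
    nonneg_of_mul_nonneg_right (h ▸ add_nonneg ha hc) hk
  have hneg : a < 0 → c < 0 → b < 0 := fun ha hc =>
    neg_of_mul_neg_right (h ▸ add_neg ha hc) hk.le
  unfold roundSign
  grind

end SignRounding

section SignCorrelation

open MeasureTheory ProbabilityTheory

variable {E : Type*} [NormedAddCommGroup E] [InnerProductSpace ℝ E] [FiniteDimensional ℝ E]
  [MeasurableSpace E]

/-- The correlation of the signs of `⟨x, g⟩` and `⟨y, g⟩` for a standard Gaussian vector `g`. -/
noncomputable def signCorr (x y : E) : ℝ :=
  ∫ g, roundSign (inner ℝ x g) * roundSign (inner ℝ y g) ∂stdGaussian E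

theorem signCorr_comm (x y : E) : signCorr x y = signCorr y x := by
  simp only [signCorr, mul_comm]

variable [BorelSpace E]

theorem integrable_roundSign_mul_roundSign (x y : E) :
    Integrable (fun g => roundSign (inner ℝ x g) * roundSign (inner ℝ y g)) (stdGaussian E) := by
  have hmeas (z : E) : Measurable fun g : E => roundSign (inner ℝ z g) :=
    measurable_roundSign.comp (by fun_prop)
  exact .of_bound ((hmeas x).mul (hmeas y)).aestronglyMeasurable 1
    (.of_forall fun g => (norm_roundSign_mul_roundSign _ _).le)

theorem abs_signCorr_le_one (x y : E) : |signCorr x y| ≤ 1 := by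
  have := norm_integral_le_of_norm_le_const (μ := stdGaussian E)
    (.of_forall fun g => (norm_roundSign_mul_roundSign (inner ℝ x g) (inner ℝ y g)).le)
  simpa [signCorr] using this

theorem signCorr_map (R : E ≃ₗᵢ[ℝ] E) (x y : E) : signCorr (R x) (R y) = signCorr x y := by
  have hpres : MeasurePreserving R (stdGaussian E) (stdGaussian E) :=
    ⟨R.continuous.measurable, stdGaussian_map R⟩
  rw [signCorr, ← hpres.integral_comp R.toHomeomorph.measurableEmbedding]
  simp only [LinearIsometryEquiv.inner_map_map, signCorr]

theorem ae_inner_stdGaussian_ne_zero {y : E} (hy : y ≠ 0) :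
    ∀ᵐ g ∂stdGaussian E, inner ℝ y g ≠ 0 := by
  have hvar : (Var[innerSL ℝ y; stdGaussian E]).toNNReal ≠ 0 := by
    rw [variance_dual_stdGaussian, innerSL_apply_norm]
    simpa using hy
  have := nullSingletonClass_gaussianReal (μ := (stdGaussian E)[innerSL ℝ y]) hvar
  have hmap : ∀ᵐ t ∂(stdGaussian E).map (innerSL ℝ y), t ≠ 0 := by
    rw [IsGaussian.map_eq_gaussianReal]
    exact Measure.ae_ne _ _
  exact ae_of_ae_map (f := innerSL ℝ y) (p := fun t => t ≠ 0) (by fun_prop) hmap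

theorem signCorr_neg_right (x : E) {y : E} (hy : y ≠ 0) : signCorr x (-y) = -signCorr x y := by
  rw [signCorr, signCorr, ← integral_neg]
  refine integral_congr_ae ?_
  filter_upwards [ae_inner_stdGaussian_ne_zero hy] with g hg
  rw [inner_neg_left, roundSign_neg hg, mul_neg]

theorem signCorr_eq_zero_of_inner_eq_zero {x y : E} (hy : y ≠ 0) (h : inner ℝ x y = 0) :
    signCorr x y = 0 := by
  have hx : (ℝ ∙ y)ᗮ.reflection x = x :=
    Submodule.reflection_mem_subspace_eq_self
      (Submodule.mem_orthogonal_singleton_iff_inner_left.2 h)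
  have hflip := signCorr_map (ℝ ∙ y)ᗮ.reflection x y
  rw [hx, Submodule.reflection_orthogonalComplement_singleton_eq_neg, signCorr_neg_right x hy]
    at hflip
  linarith

theorem signCorr_reflection {x y : E} (hxy : 0 < inner ℝ x y) :
    signCorr x ((ℝ ∙ y).reflection x) = 2 * signCorr x y - 1 := by
  set z := (ℝ ∙ y).reflection x with hz
  have hadd : x + z = (2 * (inner ℝ x y / ‖y‖ ^ 2)) • y := by
    rw [hz, Submodule.reflection_singleton_apply, real_inner_comm, mul_smul, two_smul, two_smul]
    simp
  have hRy : (ℝ ∙ y).reflection y = y :=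
    Submodule.reflection_mem_subspace_eq_self (Submodule.mem_span_singleton_self y)
  have hyz : signCorr y z = signCorr x y := by
    rw [signCorr_comm x y, ← signCorr_map (ℝ ∙ y).reflection y x, hRy]
  have hsplit (g : E) : roundSign (inner ℝ x g) * roundSign (inner ℝ z g) =
      roundSign (inner ℝ x g) * roundSign (inner ℝ y g) +
        roundSign (inner ℝ y g) * roundSign (inner ℝ z g) - 1 := by
    refine roundSign_mul_roundSign_of_add_eq (k := 2 * (inner ℝ x y / ‖y‖ ^ 2)) ?_ ?_
    · have hy : y ≠ 0 := by rintro rfl; simp at hxy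
      positivity
    · rw [← inner_add_left, hadd, real_inner_smul_left]
  calc signCorr x z = signCorr x y + signCorr y z - 1 := by
        have hxy := integrable_roundSign_mul_roundSign x y
        have hyz := integrable_roundSign_mul_roundSign y z
        simp only [signCorr, hsplit]
        rw [integral_sub (hxy.fun_add hyz) (integrable_const 1), integral_add hxy hyz,
          integral_const, probReal_univ, one_smul]
    _ = 2 * signCorr x y - 1 := by rw [hyz]; ring

end SignCorrelation

section PhiReal

theorem phiReal_zero : phiReal 0 = 0 := by
  simp [phiReal]

theorem phiReal_one : phiReal 1 = 1 := by
  rw [phiReal, Real.arcsin_one]; field_simp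

theorem phiReal_neg (t : ℝ) : phiReal (-t) = -phiReal t := by
  simp [phiReal, Real.arcsin_neg]

theorem abs_phiReal_le_one (t : ℝ) : |phiReal t| ≤ 1 := by
  rw [phiReal, abs_mul, abs_of_pos (by positivity), div_mul_eq_mul_div, div_le_one Real.pi_pos]
  linarith [abs_le.2 ⟨Real.neg_pi_div_two_le_arcsin t, Real.arcsin_le_pi_div_two t⟩]

theorem arcsin_two_mul_sq_sub_one {t : ℝ} (h0 : 0 ≤ t) (h1 : t ≤ 1) :
    Real.arcsin (2 * t ^ 2 - 1) = 2 * Real.arcsin t - Real.pi / 2 := by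
  have hsin : Real.sin (2 * Real.arcsin t - Real.pi / 2) = 2 * t ^ 2 - 1 := by
    rw [Real.sin_sub_pi_div_two, Real.cos_two_mul, Real.cos_sq', Real.sin_arcsin (by linarith) h1]
    ring
  have harcsin_nonneg := Real.arcsin_nonneg.2 h0
  have harcsin_le := Real.arcsin_le_pi_div_two t
  rw [← hsin, Real.arcsin_sin] <;> linarith

theorem phiReal_two_mul_sq_sub_one {t : ℝ} (h0 : 0 ≤ t) (h1 : t ≤ 1) :
    phiReal (2 * t ^ 2 - 1) = 2 * phiReal t - 1 := by
  rw [phiReal, phiReal, arcsin_two_mul_sq_sub_one h0 h1]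
  field_simp

theorem phiReal_nonneg {t : ℝ} (h0 : 0 ≤ t) : 0 ≤ phiReal t :=
  mul_nonneg (by positivity) (Real.arcsin_nonneg.2 h0)

theorem phiReal_le_self {t : ℝ} (h0 : 0 ≤ t) (h1 : t ≤ 1) : phiReal t ≤ t := by
  have h := Real.mul_le_sin (Real.arcsin_nonneg.2 h0) (Real.arcsin_le_pi_div_two t)
  rwa [Real.sin_arcsin (by linarith) h1] at h

end PhiReal

section GrothendieckIdentity

open MeasureTheory ProbabilityTheory

variable {E : Type*} [NormedAddCommGroup E] [InnerProductSpace ℝ E]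

theorem inner_reflection_singleton {x y : E} (hx : ‖x‖ = 1) (hy : ‖y‖ = 1) :
    inner ℝ x ((ℝ ∙ y).reflection x) = 2 * inner ℝ x y ^ 2 - 1 := by
  rw [Submodule.reflection_singleton_apply, inner_sub_right, real_inner_self_eq_norm_sq, hx, hy,
    two_smul, inner_add_right, real_inner_smul_right, real_inner_comm y x]
  simp only [Real.ringHom_apply, one_pow, div_one]
  ring

variable [FiniteDimensional ℝ E] [MeasurableSpace E] [BorelSpace E]

theorem abs_signCorr_sub_phiReal_le (k : ℕ) {x y : E} (hx : ‖x‖ = 1) (hy : ‖y‖ = 1) :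
    |signCorr x y - phiReal (inner ℝ x y)| ≤ 2 * (1 / 2) ^ k := by
  have hy0 : y ≠ 0 := norm_ne_zero_iff.1 (by simp [hy])
  induction k generalizing x y with
  | zero =>
    calc |signCorr x y - phiReal (inner ℝ x y)| ≤ |signCorr x y| + |phiReal (inner ℝ x y)| :=
          abs_sub _ _
      _ ≤ 2 * (1 / 2) ^ 0 := by
          linarith [abs_signCorr_le_one x y, abs_phiReal_le_one (inner ℝ x y)]
  | succ k ih =>
    have hpos {y : E} (hy : ‖y‖ = 1) (hxy : 0 < inner ℝ x y) :
        |signCorr x y - phiReal (inner ℝ x y)| ≤ 2 * (1 / 2) ^ (k + 1) := by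
      have hxy1 : inner ℝ x y ≤ 1 := by simpa [hx, hy] using real_inner_le_norm x y
      have hz : ‖(ℝ ∙ y).reflection x‖ = 1 := by rw [LinearIsometryEquiv.norm_map, hx]
      have hdouble := ih hx hz (norm_ne_zero_iff.1 (by simp [hz]))
      rw [signCorr_reflection hxy, inner_reflection_singleton hx hy,
        phiReal_two_mul_sq_sub_one hxy.le hxy1, sub_sub_sub_cancel_right, ← mul_sub, abs_mul,
        abs_two] at hdouble
      rw [pow_succ]
      linarith
    rcases lt_trichotomy (inner ℝ x y) 0 with hlt | heq | hgt
    · have h := hpos (y := -y) (by rwa [norm_neg]) (by rwa [inner_neg_right, neg_pos])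
      rwa [signCorr_neg_right x hy0, inner_neg_right, phiReal_neg, neg_sub_neg, abs_sub_comm] at h
    · rw [signCorr_eq_zero_of_inner_eq_zero hy0 heq, heq, phiReal_zero, sub_zero, abs_zero]
      positivity
    · exact hpos hy hgt

theorem signCorr_eq_phiReal_inner {x y : E} (hx : ‖x‖ = 1) (hy : ‖y‖ = 1) :
    signCorr x y = phiReal (inner ℝ x y) := by
  have hlim : Filter.Tendsto (fun k : ℕ => 2 * (1 / 2 : ℝ) ^ k) Filter.atTop (nhds 0) := by
    simpa using (tendsto_pow_atTop_nhds_zero_of_lt_one (r := (1 / 2 : ℝ)) (by norm_num)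
      (by norm_num)).const_mul 2
  have hle := ge_of_tendsto' hlim fun k => abs_signCorr_sub_phiReal_le k hx hy
  exact sub_eq_zero.1 (abs_nonpos_iff.1 hle)

theorem sum_mul_phiReal_inner_le_thetaSeminorm {n : ℕ} (A : Matrix (Fin n) (Fin n) ℝ)
    {x : Fin n → E} (hx : ∀ i, ‖x i‖ = 1) :
    ∑ i, ∑ j, A i j * phiReal (inner ℝ (x i) (x j)) ≤ thetaSeminorm A := by
  let s (i : Fin n) (g : E) : ℝ := roundSign (inner ℝ (x i) g)
  have hint (i j) : Integrable (fun g => A i j * (s i g * s j g)) (stdGaussian E) :=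
    (integrable_roundSign_mul_roundSign (x i) (x j)).const_mul _
  have hle (g : E) : ∑ i, ∑ j, A i j * (s i g * s j g) ≤ thetaSeminorm A :=
    (le_abs_self _).trans ((thetaSeminorm_isGreatest A).2
      ⟨fun i => s i g, fun i => abs_roundSign _, rfl⟩)
  calc ∑ i, ∑ j, A i j * phiReal (inner ℝ (x i) (x j))
      = ∫ g, ∑ i, ∑ j, A i j * (s i g * s j g) ∂stdGaussian E := by
        rw [integral_finsetSum _ fun i _ => integrable_finsetSum _ fun j _ => hint i j]
        simp only [integral_finsetSum _ fun j _ => hint _ j, integral_const_mul,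
          ← signCorr_eq_phiReal_inner (hx _) (hx _), signCorr, s]
    _ ≤ ∫ _, thetaSeminorm A ∂stdGaussian E :=
        integral_mono (integrable_finsetSum _ fun i _ => integrable_finsetSum _ fun j _ => hint i j)
          (integrable_const _) hle
    _ = thetaSeminorm A := by simp

end GrothendieckIdentity

section Constants

theorem le_tangent_of_concaveOn {f : ℝ → ℝ} {f' x y : ℝ} {S : Set ℝ} (hf : ConcaveOn ℝ S f)
    (hx : x ∈ S) (hy : y ∈ S) (hf' : HasDerivAt f f' x) : f y ≤ f x + f' * (y - x) := by
  rcases lt_trichotomy x y with h | rfl | h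
  · have hslope := hf.slope_le_of_hasDerivAt hx hy h hf'
    rw [slope_def_field, div_le_iff₀ (sub_pos.2 h)] at hslope
    linarith
  · simp
  · have hslope := hf.le_slope_of_hasDerivAt hy hx h hf'
    rw [slope_def_field, le_div_iff₀ (sub_pos.2 h)] at hslope
    linarith

theorem sin_le_sqrt_two_div_two_mul {s : ℝ} (hs : s ∈ Set.Icc 0 Real.pi) :
    Real.sin s ≤ √2 / 2 * (1 + (s - Real.pi / 4)) := by
  have hpi : Real.pi / 4 ∈ Set.Icc 0 Real.pi := by
    constructor <;> linarith [Real.pi_pos]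
  have h := le_tangent_of_concaveOn strictConcaveOn_sin_Icc.concaveOn hpi hs
    (Real.hasDerivAt_sin _)
  rw [Real.sin_pi_div_four, Real.cos_pi_div_four] at h
  linarith

theorem inv_two_le_one_add_div_one_add {p t : ℝ} (hp : 0 ≤ p) (h0 : 0 ≤ t) (h1 : t ≤ 1) :
    2⁻¹ ≤ (1 + p) / (1 + t) := by
  rw [le_div_iff₀ (by linarith)]; linarith

theorem alphaReal_mul_one_add_le {t : ℝ} (h0 : 0 ≤ t) (h1 : t ≤ 1) :
    alphaReal * (1 + t) ≤ 1 + phiReal t := by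
  rw [← le_div_iff₀ (by linarith)]
  refine csInf_le ⟨2⁻¹, ?_⟩ ⟨t, ⟨h0, h1⟩, rfl⟩
  rintro _ ⟨t, ⟨h0, h1⟩, rfl⟩
  exact inv_two_le_one_add_div_one_add (phiReal_nonneg h0) h0 h1

theorem alphaReal_le_one : alphaReal ≤ 1 := by
  simpa [phiReal_zero] using alphaReal_mul_one_add_le le_rfl zero_le_one

theorem five_sixths_le_alphaReal : 5 / 6 ≤ alphaReal := by
  refine le_csInf ⟨_, 0, by simp, rfl⟩ ?_
  rintro _ ⟨t, ⟨h0, h1⟩, rfl⟩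
  rw [le_div_iff₀ (by linarith)]
  set s := Real.arcsin t
  have hs0 : 0 ≤ s := Real.arcsin_nonneg.2 h0
  have hspi : s ≤ Real.pi / 2 := Real.arcsin_le_pi_div_two t
  have htangent := sin_le_sqrt_two_div_two_mul (s := s) ⟨hs0, by linarith⟩
  rw [Real.sin_arcsin (by linarith) h1] at htangent
  have hsqrt : √2 / 2 ≤ 0.708 := by
    rw [div_le_iff₀ two_pos, Real.sqrt_le_left (by norm_num)]; norm_num
  have hpi_gt := Real.pi_gt_d2
  have hpi_lt := Real.pi_lt_d2
  have ht : t ≤ 0.708 * (1 + (s - Real.pi / 4)) :=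
    htangent.trans (mul_le_mul_of_nonneg_right hsqrt (by linarith))
  have hphi : 0.634 * s ≤ phiReal t := by
    refine mul_le_mul_of_nonneg_right ?_ hs0
    rw [le_div_iff₀ Real.pi_pos]; linarith
  linarith

theorem alphaReal_mem_Ioc : alphaReal ∈ Set.Ioc 0 1 :=
  ⟨lt_of_lt_of_le (by norm_num) five_sixths_le_alphaReal, alphaReal_le_one⟩

theorem abs_phiReal_sub_alphaReal_mul_le {t : ℝ} (ht : |t| ≤ 1) :
    |phiReal t - alphaReal * t| ≤ 1 - alphaReal := by
  have hnonneg {t : ℝ} (h0 : 0 ≤ t) (h1 : t ≤ 1) :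
      |phiReal t - alphaReal * t| ≤ 1 - alphaReal := by
    rw [abs_le]
    constructor
    · linarith [alphaReal_mul_one_add_le h0 h1]
    · have := mul_le_mul_of_nonneg_left h1 (sub_nonneg.2 alphaReal_le_one)
      linarith [phiReal_le_self h0 h1]
  rcases le_total 0 t with h | h
  · exact hnonneg h (le_of_abs_le ht)
  · have := hnonneg (neg_nonneg.2 h) ((neg_le_abs t).trans ht)
    rwa [phiReal_neg, mul_neg, neg_sub_neg, abs_sub_comm] at this

theorem phiComplex_re_nonneg {x : ℝ} (h0 : 0 ≤ x) : 0 ≤ (phiComplex x).re := by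
  have h : phiComplex x =
      ((Real.pi / 4 * ∑' k : ℕ, phiCoeff k * (x * |x| ^ (2 * k)) : ℝ) : ℂ) := by
    rw [phiComplex, Complex.norm_real, Real.norm_eq_abs]
    push_cast
    rfl
  rw [h, Complex.ofReal_re]
  exact mul_nonneg (by positivity)
    (tsum_nonneg fun k => mul_nonneg (phiCoeff_nonneg k) (by positivity))

theorem alphaComplex_mem_Ioc : alphaComplex ∈ Set.Ioc 0 1 := by
  have hlower : ∀ r ∈ (fun x : ℝ => (1 + (phiComplex (x : ℂ)).re) / (1 + x)) '' Set.Icc 0 1,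
      2⁻¹ ≤ r := by
    rintro _ ⟨x, ⟨h0, h1⟩, rfl⟩
    exact inv_two_le_one_add_div_one_add (phiComplex_re_nonneg h0) h0 h1
  exact ⟨lt_of_lt_of_le (by norm_num) (le_csInf ⟨_, 0, by simp, rfl⟩ hlower),
    csInf_le ⟨_, hlower⟩ ⟨0, by simp, by simp [phiComplex]⟩⟩

theorem inv_alphaReal_le {a β : ℝ} (ha : a ≤ 4 / 5) (hβ : β ∈ Set.Ioc 0 1) :
    alphaReal⁻¹ ≤ 1 + (1 - a) / β :=
  calc alphaReal⁻¹ ≤ (5 / 6)⁻¹ := inv_anti₀ (by norm_num) five_sixths_le_alphaReal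
    _ ≤ 1 + (1 - a) := by linarith
    _ ≤ 1 + (1 - a) / β := by gcongr; exact le_div_self (by linarith) hβ.1 hβ.2

theorem inv_alphaReal_le_one_add_div_alphaReal :
    alphaReal⁻¹ ≤ 1 + (1 - 2 / Real.pi) / alphaReal := by
  refine inv_alphaReal_le ?_ alphaReal_mem_Ioc
  rw [div_le_iff₀ Real.pi_pos]
  linarith [Real.pi_gt_d2]

theorem inv_alphaReal_le_one_add_div_alphaComplex :
    alphaReal⁻¹ ≤ 1 + (1 - Real.pi / 4) / alphaComplex :=
  inv_alphaReal_le (by linarith [Real.pi_lt_d2]) alphaComplex_mem_Ioc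

end Constants

section DiagDominant

variable {n : ℕ} {A : Matrix (Fin n) (Fin n) ℝ}

theorem IsSymmDiagDominant.diag_nonneg (hA : IsSymmDiagDominant A) (i : Fin n) : 0 ≤ A i i :=
  (Finset.sum_nonneg fun _ _ => abs_nonneg _).trans (hA.2 i)

theorem IsSymmDiagDominant.sum_mul_swap (hA : IsSymmDiagDominant A) (f : Fin n → Fin n → ℝ) :
    ∑ i, ∑ j, A i j * f j i = ∑ i, ∑ j, A i j * f i j := by
  rw [Finset.sum_comm]
  simp only [hA.1.apply]

theorem IsSymmDiagDominant.sum_mul_nonneg (hA : IsSymmDiagDominant A) {f : Fin n → Fin n → ℝ}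
    (hf : ∀ i j, |f i j| ≤ (f i i + f j j) / 2) : 0 ≤ ∑ i, ∑ j, A i j * f i j := by
  have hdiag (i : Fin n) : 0 ≤ f i i := by linarith [(abs_nonneg _).trans (hf i i)]
  have hentry (i j : Fin n) :
      (if i = j then 2 * A i i * f i i else 0) - |A i j| * ((f i i + f j j) / 2) ≤
        A i j * f i j := by
    split_ifs with h
    · subst h
      rw [abs_of_nonneg (hA.diag_nonneg i)]
      linarith
    · have := mul_le_mul_of_nonneg_left (hf i j) (abs_nonneg (A i j))
      rw [← abs_mul] at this
      linarith [neg_abs_le (A i j * f i j)]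
  have hrow (i : Fin n) : ∑ j, |A i j| ≤ 2 * A i i := by
    rw [← Finset.add_sum_erase _ _ (Finset.mem_univ i), abs_of_nonneg (hA.diag_nonneg i)]
    linarith [hA.2 i]
  have hswap : ∑ i, ∑ j, |A i j| * f j j = ∑ i, ∑ j, |A i j| * f i i := by
    rw [Finset.sum_comm]
    simp only [hA.1.apply]
  calc 0 ≤ ∑ i, (2 * A i i - ∑ j, |A i j|) * f i i :=
        Finset.sum_nonneg fun i _ => mul_nonneg (sub_nonneg.2 (hrow i)) (hdiag i)
    _ = ∑ i, ∑ j, ((if i = j then 2 * A i i * f i i else 0) -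
          |A i j| * ((f i i + f j j) / 2)) := by
        simp only [sub_mul, Finset.sum_mul, Finset.sum_sub_distrib, Finset.sum_ite_eq,
          Finset.mem_univ, if_true, mul_add, add_div, mul_div_assoc', Finset.sum_add_distrib,
          ← Finset.sum_div, hswap]
        ring
    _ ≤ ∑ i, ∑ j, A i j * f i j :=
        Finset.sum_le_sum fun i _ => Finset.sum_le_sum fun j _ => hentry i j

variable {F : Type*} [NormedAddCommGroup F] [InnerProductSpace ℝ F]

theorem IsSymmDiagDominant.sum_inner_self_nonneg (hA : IsSymmDiagDominant A) (x : Fin n → F) :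
    0 ≤ ∑ i, ∑ j, A i j * inner ℝ (x i) (x j) := by
  refine hA.sum_mul_nonneg fun i j => (abs_real_inner_le_norm _ _).trans ?_
  rw [real_inner_self_eq_norm_sq, real_inner_self_eq_norm_sq]
  linarith [two_mul_le_add_sq ‖x i‖ ‖x j‖]

theorem exists_norm_eq_one_inner_eq_of_ne {ι : Type*} [Fintype ι] {x : ι → F}
    (hx : ∀ i, ‖x i‖ ≤ 1) :
    ∃ y : ι → WithLp 2 (F × EuclideanSpace ℝ ι),
      (∀ i, ‖y i‖ = 1) ∧ ∀ i j, i ≠ j → inner ℝ (y i) (y j) = inner ℝ (x i) (x j) := by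
  classical
  refine ⟨fun i => WithLp.toLp 2 (x i, EuclideanSpace.single i √(1 - ‖x i‖ ^ 2)),
    fun i => ?_, fun i j hij => ?_⟩
  · rw [WithLp.prod_norm_eq_of_L2]
    simp [Real.sq_sqrt (sub_nonneg.2 (pow_le_one₀ (norm_nonneg _) (hx i)))]
  · simp [WithLp.prod_inner_apply, EuclideanSpace.inner_single_left, hij]

variable [FiniteDimensional ℝ F]

theorem IsSymmDiagDominant.sum_inner_self_le_of_norm_eq_one (hA : IsSymmDiagDominant A)
    {x : Fin n → F} (hx : ∀ i, ‖x i‖ = 1) :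
    ∑ i, ∑ j, A i j * inner ℝ (x i) (x j) ≤ alphaReal⁻¹ * thetaSeminorm A := by
  borelize F
  have hself (i : Fin n) : inner ℝ (x i) (x i) = 1 := by
    rw [real_inner_self_eq_norm_sq, hx, one_pow]
  have hgap : 0 ≤ ∑ i, ∑ j,
      A i j * (phiReal (inner ℝ (x i) (x j)) - alphaReal * inner ℝ (x i) (x j)) := by
    refine hA.sum_mul_nonneg fun i j => ?_
    rw [hself, hself, phiReal_one, mul_one, add_self_div_two]
    exact abs_phiReal_sub_alphaReal_mul_le
      ((abs_real_inner_le_norm _ _).trans_eq (by rw [hx, hx, one_mul]))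
  rw [le_inv_mul_iff₀ alphaReal_mem_Ioc.1]
  calc alphaReal * ∑ i, ∑ j, A i j * inner ℝ (x i) (x j)
      ≤ ∑ i, ∑ j, A i j * phiReal (inner ℝ (x i) (x j)) := by
        simp only [mul_sub, Finset.sum_sub_distrib] at hgap
        simp only [Finset.mul_sum, mul_left_comm alphaReal]
        linarith
    _ ≤ thetaSeminorm A := sum_mul_phiReal_inner_le_thetaSeminorm A hx

theorem IsSymmDiagDominant.sum_inner_self_le (hA : IsSymmDiagDominant A) {x : Fin n → F}
    (hx : ∀ i, ‖x i‖ ≤ 1) :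
    ∑ i, ∑ j, A i j * inner ℝ (x i) (x j) ≤ alphaReal⁻¹ * thetaSeminorm A := by
  obtain ⟨y, hy, hxy⟩ := exists_norm_eq_one_inner_eq_of_ne hx
  refine le_trans (Finset.sum_le_sum fun i _ => Finset.sum_le_sum fun j _ => ?_)
    (hA.sum_inner_self_le_of_norm_eq_one hy)
  rcases eq_or_ne i j with rfl | hij
  · rw [real_inner_self_eq_norm_sq, real_inner_self_eq_norm_sq, hy, one_pow]
    exact mul_le_mul_of_nonneg_left (pow_le_one₀ (norm_nonneg _) (hx i)) (hA.diag_nonneg i)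
  · rw [hxy i j hij]

/-- Polarization: `2⟨u, v⟩ = ⟨u, u⟩ + ⟨v, v⟩ - ⟨u - v, u - v⟩`, and diagonally dominant matrices
are positive semidefinite. -/
theorem IsSymmDiagDominant.sum_inner_le (hA : IsSymmDiagDominant A) {x y : Fin n → F}
    (hx : ∀ i, ‖x i‖ ≤ 1) (hy : ∀ i, ‖y i‖ ≤ 1) :
    ∑ i, ∑ j, A i j * inner ℝ (x i) (y j) ≤ alphaReal⁻¹ * thetaSeminorm A := by
  have hdiff := hA.sum_inner_self_nonneg fun i => x i - y i
  have hcross : ∑ i, ∑ j, A i j * inner ℝ (y i) (x j) = ∑ i, ∑ j, A i j * inner ℝ (x i) (y j) := by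
    rw [← hA.sum_mul_swap]
    simp only [real_inner_comm]
  simp only [inner_sub_left, inner_sub_right, mul_sub, Finset.sum_sub_distrib, hcross] at hdiff
  linarith [hA.sum_inner_self_le hx, hA.sum_inner_self_le hy]

end DiagDominant

section Fields

variable {𝕜 : Type*} [RCLike 𝕜] {n : ℕ} {A : Matrix (Fin n) (Fin n) ℝ}

theorem IsSymmDiagDominant.norm_sum_inner_le {E : Type*} [NormedAddCommGroup E]
    [InnerProductSpace 𝕜 E] [FiniteDimensional 𝕜 E] (hA : IsSymmDiagDominant A) {x y : Fin n → E}
    (hx : ∀ i, ‖x i‖ ≤ 1) (hy : ∀ i, ‖y i‖ ≤ 1) :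
    ‖∑ i, ∑ j, (A i j : 𝕜) * inner 𝕜 (x i) (y j)‖ ≤ alphaReal⁻¹ * thetaSeminorm A := by
  let _ : InnerProductSpace ℝ E := InnerProductSpace.rclikeToReal 𝕜 E
  have : IsScalarTower ℝ 𝕜 E := ⟨fun a c v => by rw [Algebra.smul_def, mul_smul]; rfl⟩
  have : FiniteDimensional ℝ E := FiniteDimensional.trans ℝ 𝕜 E
  obtain ⟨c, hc, hphase⟩ :=
    RCLike.exists_norm_eq_mul_self (∑ i, ∑ j, (A i j : 𝕜) * inner 𝕜 (x i) (y j))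
  have hcy (j : Fin n) : ‖c • y j‖ ≤ 1 := by rw [norm_smul, hc, one_mul]; exact hy j
  calc ‖∑ i, ∑ j, (A i j : 𝕜) * inner 𝕜 (x i) (y j)‖
      = RCLike.re (c * ∑ i, ∑ j, (A i j : 𝕜) * inner 𝕜 (x i) (y j)) := by
        rw [← hphase, RCLike.ofReal_re]
    _ = ∑ i, ∑ j, A i j * inner ℝ (x i) (c • y j) := by
        simp only [Finset.mul_sum, map_sum, real_inner_eq_re_inner 𝕜, inner_smul_right,
          mul_left_comm c, RCLike.re_ofReal_mul]
    _ ≤ alphaReal⁻¹ * thetaSeminorm A := hA.sum_inner_le hx hcy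

theorem IsSymmDiagDominant.le_inv_alphaReal_mul_thetaSeminorm (hA : IsSymmDiagDominant A)
    {d e : ℕ} (hd : n ≤ d) {N : ℝ}
    (hN : N ∈ ({gammaSeminorm d (A.map (RCLike.ofReal : ℝ → 𝕜)),
      capGammaNorm d (A.map (RCLike.ofReal : ℝ → 𝕜)),
      gNorm e (A.map (RCLike.ofReal : ℝ → 𝕜))} : Set ℝ)) :
    N ≤ alphaReal⁻¹ * thetaSeminorm A := by
  rcases hN with rfl | rfl | rfl
  · obtain ⟨x, hx, h⟩ := (gammaSeminorm_isGreatest hd (A.map (RCLike.ofReal : ℝ → 𝕜))).1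
    exact h.trans_le (hA.norm_sum_inner_le (fun i => (hx i).le) fun i => (hx i).le)
  · obtain ⟨x, hx, h⟩ := (capGammaNorm_isGreatest d (A.map (RCLike.ofReal : ℝ → 𝕜))).1
    exact h.trans_le (hA.norm_sum_inner_le hx hx)
  · obtain ⟨x, y, hx, hy, h⟩ := (gNorm_isGreatest e (A.map (RCLike.ofReal : ℝ → 𝕜))).1
    exact h.trans_le (hA.norm_sum_inner_le hx hy)

theorem thetaSeminorm_le_map (A : Matrix (Fin n) (Fin n) ℝ) :
    thetaSeminorm A ≤ thetaSeminorm (A.map (RCLike.ofReal : ℝ → 𝕜)) := by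
  obtain ⟨δ, hδ, h⟩ := (thetaSeminorm_isGreatest A).1
  refine (thetaSeminorm_isGreatest _).2 ⟨fun i => (δ i : 𝕜), fun i => ?_, ?_⟩
  · rw [RCLike.norm_ofReal, ← Real.norm_eq_abs, hδ]
  · rw [h, Real.norm_eq_abs, ← RCLike.norm_ofReal (K := 𝕜)]
    simp

theorem thetaSeminorm_le_of_mem_theta_norms {B : Matrix (Fin n) (Fin n) 𝕜} {M : ℝ}
    (hM : M ∈ ({thetaSeminorm B, capThetaNorm B, inftyOneNorm B} : Set ℝ)) :
    thetaSeminorm B ≤ M := by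
  obtain ⟨δ, hδ, h⟩ := (thetaSeminorm_isGreatest B).1
  rcases hM with rfl | rfl | rfl
  · exact le_rfl
  · exact (capThetaNorm_isGreatest B).2 ⟨δ, fun i => (hδ i).le, h⟩
  · exact (inftyOneNorm_isGreatest B).2 ⟨δ, δ, fun i => (hδ i).le, fun i => (hδ i).le, h⟩

theorem nonneg_of_mem_theta_norms {B : Matrix (Fin n) (Fin n) 𝕜} {M : ℝ}
    (hM : M ∈ ({thetaSeminorm B, capThetaNorm B, inftyOneNorm B} : Set ℝ)) : 0 ≤ M :=
  have hθ : 0 ≤ thetaSeminorm B := Real.sSup_nonneg fun _ ⟨_, _, hr⟩ => hr ▸ norm_nonneg _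
  hθ.trans (thetaSeminorm_le_of_mem_theta_norms hM)

end Fields

end Groth

theorem proposition5p4_general {𝕜 : Type*} [RCLike 𝕜] {n d e : ℕ} (hd : n ≤ d)
    {A : Matrix (Fin n) (Fin n) ℝ} (hA : Groth.IsSymmDiagDominant A) {N M : ℝ}
    (hN : N ∈ ({Groth.gammaSeminorm d (A.map (RCLike.ofReal : ℝ → 𝕜)),
      Groth.capGammaNorm d (A.map (RCLike.ofReal : ℝ → 𝕜)),
      Groth.gNorm e (A.map (RCLike.ofReal : ℝ → 𝕜))} : Set ℝ))
    (hM : M ∈ ({Groth.thetaSeminorm (A.map (RCLike.ofReal : ℝ → 𝕜)),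
      Groth.capThetaNorm (A.map (RCLike.ofReal : ℝ → 𝕜)),
      Groth.inftyOneNorm (A.map (RCLike.ofReal : ℝ → 𝕜))} : Set ℝ)) :
    N ≤ Groth.alphaReal⁻¹ * M :=
  (hA.le_inv_alphaReal_mul_thetaSeminorm hd hN).trans <| mul_le_mul_of_nonneg_left
    ((Groth.thetaSeminorm_le_map A).trans (Groth.thetaSeminorm_le_of_mem_theta_norms hM))
    (inv_nonneg.2 Groth.alphaReal_mem_Ioc.1.le)

theorem proposition5p4 (n d e : ℕ) (hd : n ≤ d) (he : n + n ≤ e)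
    (A : Matrix (Fin n) (Fin n) ℝ) (hA : Groth.IsSymmDiagDominant A) :
    -- over the real field
    (∀ N ∈ ({Groth.gammaSeminorm d A, Groth.capGammaNorm d A, Groth.gNorm e A} : Set ℝ),
      ∀ M ∈ ({Groth.thetaSeminorm A, Groth.capThetaNorm A, Groth.inftyOneNorm A} : Set ℝ),
        N ≤ (1 + (1 - 2 / Real.pi) / Groth.alphaReal) * M) ∧
    -- over the complex field, with the same real matrix regarded as a complex one
    (∀ N ∈ ({Groth.gammaSeminorm d (A.map Complex.ofReal),
        Groth.capGammaNorm d (A.map Complex.ofReal),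
        Groth.gNorm e (A.map Complex.ofReal)} : Set ℝ),
      ∀ M ∈ ({Groth.thetaSeminorm (A.map Complex.ofReal),
          Groth.capThetaNorm (A.map Complex.ofReal),
          Groth.inftyOneNorm (A.map Complex.ofReal)} : Set ℝ),
        N ≤ (1 + (1 - Real.pi / 4) / Groth.alphaComplex) * M) := by
  refine ⟨fun N hN M hM => (proposition5p4_general (𝕜 := ℝ) hd hA hN hM).trans ?_,
    fun N hN M hM => (proposition5p4_general (𝕜 := ℂ) hd hA hN hM).trans ?_⟩
  · exact mul_le_mul_of_nonneg_right Groth.inv_alphaReal_le_one_add_div_alphaReal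
      (Groth.nonneg_of_mem_theta_norms hM)
  · exact mul_le_mul_of_nonneg_right Groth.inv_alphaReal_le_one_add_div_alphaComplex
      (Groth.nonneg_of_mem_theta_norms hM)
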